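/- Let $E$ be a real Banach space of dimension at least $2$ and let $D\subsetneq E$ be a proper domain (nonempty, open, connected, $D\ne E$). For a proper domain $U\subset E$ let $d_U(z)$ be the distance from $z$ to $\partial U$, and let $$k_U(z_1,z_2)=\inf_\gamma\int_\gamma\frac{|dz|}{d_U(z)}\qquad(z_1,z_2\in U)$$ be the quasihyperbolic distance, where the infimum is over all rectifiable arcs $\gamma$ in $U$ joining $z_1$ and $z_2$. For a homeomorphism $\psi:[0,\infty)\to[0,\infty)$, the proper domain $U$ is called $\psi$-uniform if $$k_U(z_1,z_2)\le\psi\left(\frac{|z_1-z_2|}{\min\{d_U(z_1),d_U(z_2)\}}\right)\qquad\text{for all } z_1,z_2\in U.$$ Let $P\subset D$ be a countable set, closed relative to $D$, with $k_D(x,y)\ge\frac12$ for all distinct $x,y\in P$, and let $G=D\setminus P$. Then the following hold. 1. If $\psi:[0,\infty)\to[0,\infty)$ is a homeomorphism and $D$ is $\psi$-uniform, then $G$ is a $\psi_1$-uniform domain, where $\psi_1(t)=2^{12}\psi(t)$ for $t\ge0$. 2. If $\psi_1:[0,\infty)\to[0,\infty)$ is a homeomorphism and $G$ is a $\psi_1$-uniform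 domain, then $D$ is $\psi$-uniform, where $\psi(t)=3\psi_1(2^7t)$ for $t\ge0$. -/

import Mathlib

open scoped NNReal ENNReal

/-- A nonempty connected open proper subset of `E`. (Properness makes the boundary nonempty, so
that the distance to the boundary is meaningful.) -/
structure IsProperDomain {E : Type*} [NormedAddCommGroup E] (D : Set E) : Prop where
  isOpen : IsOpen D
  isConnected : IsConnected D
  ne_univ : D ≠ Set.univ

/-- `d_D(z)`: the distance from `z` to the boundary of `D`. -/
noncomputable def bdryDist {E : Type*} [NormedAddCommGroup E] (D : Set E) (z : E) : ℝ≥0 :=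
  Metric.infNndist z (frontier D)

/-- `γ`, restricted to `[0, L]`, is the arc-length parametrization of a rectifiable arc of
length `L` in `D` from `x` to `y`. (Unit speed says that every subarc `γ[s, t]` has length
`t - s`; in particular `γ` is continuous on `[0, L]`. If `x = y`, then `L = 0`.) -/
structure IsArcFromTo {E : Type*} [NormedAddCommGroup E] (D : Set E) (x y : E) (L : ℝ)
    (γ : ℝ → E) : Prop where
  length_nonneg : 0 ≤ L
  unitSpeed : HasUnitSpeedOn γ (Set.Icc 0 L)
  injOn : Set.InjOn γ (Set.Icc 0 L)
  mapsTo : Set.MapsTo γ (Set.Icc 0 L) D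
  source : γ 0 = x
  target : γ L = y

/-- The quasihyperbolic length `∫_γ |dz| / d_D(z)` of an arc `γ` given by its arc-length
parametrization on `[0, L]`. -/
noncomputable def qhLength {E : Type*} [NormedAddCommGroup E] (D : Set E) (L : ℝ) (γ : ℝ → E) :
    ℝ≥0∞ :=
  ∫⁻ t in Set.Icc (0 : ℝ) L, (bdryDist D (γ t) : ℝ≥0∞)⁻¹

/-- The quasihyperbolic distance `k_D(x, y)`: the infimum of the quasihyperbolic lengths of the
rectifiable arcs in `D` from `x` to `y`. -/
noncomputable def qhDist {E : Type*} [NormedAddCommGroup E] (D : Set E) (x y : E) : ℝ≥0∞ :=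
  ⨅ (L : ℝ) (γ : ℝ → E) (_ : IsArcFromTo D x y L γ), qhLength D L γ

/-- `D` is a `ψ`-uniform domain, where `ψ : [0, ∞) → [0, ∞)` is a homeomorphism. -/
structure IsPsiUniform {E : Type*} [NormedAddCommGroup E] (ψ : ℝ≥0 ≃ₜ ℝ≥0) (D : Set E) :
    Prop where
  domain : IsProperDomain D
  qhDist_le : ∀ z₁ ∈ D, ∀ z₂ ∈ D,
    qhDist D z₁ z₂ ≤ (ψ (nndist z₁ z₂ / min (bdryDist D z₁) (bdryDist D z₂)) : ℝ≥0∞)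

/-!
# Uniformity of a domain and of its complement of a sparse set

Straight segments show that distinct points `x, y` of `P`, being at quasihyperbolic distance at
least `1 / 2`, satisfy `|x - y| ≥ d_D(x) / 3` (`isSparseIn_of_qhDist`).
So around each `x ∈ P` there is a ball of radius `d_D(x) / 6` that contains no other point of `P`,
and in this ball the boundary distance of
`G = D \ P` is the distance to `x` (`IsSparseIn.mem_diff_and_dist_le`). In such a punctured ball
two points are joined by a radial segment followed by two chords that stay away from the centre,
which exist because the dimension is at least `2`; hence the quasihyperbolic distance in `G` of `a`
and `b` is at most a constant plus a logarithm of their relative distance as long as `|a - b| ≤ d_D(a) / 20`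
(`IsSparseIn.qhDist_diff_le_of_dist_le`). Both control functions dominate `log (1 + t)`
(`IsPsiUniform.log_le`), which takes care of logarithmic terms and, when `t` is bounded below, of
constants.

From `D` to `G`: for distant points, an almost shortest arc in `D` is cut into pieces of
quasihyperbolic length less than `1 / 46`, each cutting point is moved to a nearby point where
`d_G` and `d_D` are comparable (`IsSparseIn.exists_near`), and consecutive points are at bounded
distance in `G`. The number of pieces is bounded by a multiple of the length of the arc and an additive
constant (`IsSparseIn.qhDist_diff_le_of_qhDist_lt`, `IsSparseIn.qhDist_diff_le`).

From `G` to `D`: the quasihyperbolic distance of `D` is at most that of `G`, so it is enough to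
move the two points to places where `d_G` and `d_D` are comparable, at a bounded cost
(`IsSparseIn.isPsiUniform_of_diff`).

All these steps use that the quasihyperbolic distance, an infimum over injective arcs, satisfies
the triangle inequality (`qhDist_triangle`).
-/

section

open Set Metric MeasureTheory

/-! ### Unit-speed parametrizations -/

section UnitSpeed

variable {E : Type*} [NormedAddCommGroup E]

theorem HasUnitSpeedOn.dist_le {γ : ℝ → E} {s : Set ℝ} (h : HasUnitSpeedOn γ s) {x y : ℝ}
    (hx : x ∈ s) (hy : y ∈ s) : dist (γ x) (γ y) ≤ |x - y| := by
  wlog hxy : x ≤ y generalizing x y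
  · rw [dist_comm, abs_sub_comm]
    exact this hy hx (le_of_not_ge hxy)
  have h1 : edist (γ x) (γ y) ≤ eVariationOn γ (s ∩ Icc x y) :=
    eVariationOn.edist_le γ ⟨hx, left_mem_Icc.2 hxy⟩ ⟨hy, right_mem_Icc.2 hxy⟩
  rw [h hx hy, edist_dist, NNReal.coe_one, one_mul,
    ENNReal.ofReal_le_ofReal_iff (sub_nonneg.2 hxy)] at h1
  rwa [abs_sub_comm, abs_of_nonneg (sub_nonneg.2 hxy)]

theorem HasUnitSpeedOn.continuousOn {γ : ℝ → E} {s : Set ℝ} (h : HasUnitSpeedOn γ s) :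
    ContinuousOn γ s := by
  refine LipschitzOnWith.continuousOn (K := 1) (LipschitzOnWith.of_dist_le_mul fun x hx y hy => ?_)
  simpa [Real.dist_eq] using h.dist_le hx hy

theorem HasUnitSpeedOn.congr {γ γ' : ℝ → E} {s : Set ℝ} (h : HasUnitSpeedOn γ s)
    (hγ : EqOn γ' γ s) : HasUnitSpeedOn γ' s := by
  intro x hx y hy
  rw [eVariationOn.congr (hγ.mono inter_subset_left)]
  exact h hx hy

theorem HasUnitSpeedOn.mono_Icc {γ : ℝ → E} {a b a' b' : ℝ} (h : HasUnitSpeedOn γ (Icc a b))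
    (ha : a ≤ a') (hb : b' ≤ b) : HasUnitSpeedOn γ (Icc a' b') := by
  have hsub : Icc a' b' ⊆ Icc a b := Icc_subset_Icc ha hb
  intro x hx y hy
  rw [← h (hsub hx) (hsub hy), Icc_inter_Icc, Icc_inter_Icc]
  simp only [sup_of_le_right hx.1, inf_of_le_right hy.2, sup_of_le_right (hsub hx).1,
    inf_of_le_right (hsub hy).2]

theorem HasUnitSpeedOn.comp_const_add {γ : ℝ → E} {a b : ℝ} (h : HasUnitSpeedOn γ (Icc a b))
    (c : ℝ) : HasUnitSpeedOn (fun t => γ (c + t)) (Icc (a - c) (b - c)) := by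
  intro x hx y hy
  have hx' : c + x ∈ Icc a b := ⟨by linarith [hx.1], by linarith [hx.2]⟩
  have hy' : c + y ∈ Icc a b := ⟨by linarith [hy.1], by linarith [hy.2]⟩
  have h1 := h hx' hy'
  have h2 : (fun t => γ (c + t)) = γ ∘ (fun t => c + t) := rfl
  rw [h2, eVariationOn.comp_eq_of_monotoneOn γ (fun t => c + t)
    (fun u _ v _ huv => by simpa using huv), Icc_inter_Icc, image_const_add_Icc]
  rw [Icc_inter_Icc, sup_of_le_right hx'.1, inf_of_le_right hy'.2] at h1
  rw [sup_of_le_right hx.1, inf_of_le_right hy.2, h1]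
  congr 2
  ring

theorem HasUnitSpeedOn.comp_const_sub {γ : ℝ → E} {a b : ℝ} (h : HasUnitSpeedOn γ (Icc a b))
    (c : ℝ) : HasUnitSpeedOn (fun t => γ (c - t)) (Icc (c - b) (c - a)) := by
  intro x hx y hy
  have hx' : c - x ∈ Icc a b := ⟨by linarith [hx.2], by linarith [hx.1]⟩
  have hy' : c - y ∈ Icc a b := ⟨by linarith [hy.2], by linarith [hy.1]⟩
  have h1 := h hy' hx'
  have h2 : (fun t => γ (c - t)) = γ ∘ (fun t => c - t) := rfl
  rw [h2, eVariationOn.comp_eq_of_antitoneOn γ (fun t => c - t)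
    (fun u _ v _ huv => sub_le_sub_left huv c), Icc_inter_Icc, image_const_sub_Icc]
  rw [Icc_inter_Icc, sup_of_le_right hy'.1, inf_of_le_right hx'.2] at h1
  rw [sup_of_le_right hx.1, inf_of_le_right hy.2, h1]
  congr 2
  ring

theorem Isometry.hasUnitSpeedOn {γ : ℝ → E} (h : Isometry γ) (s : Set ℝ) :
    HasUnitSpeedOn γ s := by
  refine hasConstantSpeedOnWith_iff_ordered.2 fun x hx y hy hxy => ?_
  have h1 : eVariationOn γ (s ∩ Icc x y) = eVariationOn (id : ℝ → ℝ) (s ∩ Icc x y) := by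
    simp only [eVariationOn, h.edist_eq, id]
  rw [h1, NNReal.coe_one, one_mul]
  exact (monotone_id.monotoneOn s).eVariationOn_eq hx hy

end UnitSpeed

/-! ### The quasihyperbolic distance as a pseudometric -/

section QhDist

variable {E : Type*} [NormedAddCommGroup E] {U : Set E}

theorem continuous_bdryDist (U : Set E) : Continuous (bdryDist U) :=
  continuous_infNndist_pt _

theorem qhDist_le_qhLength {x y : E} {L : ℝ} {γ : ℝ → E} (h : IsArcFromTo U x y L γ) :
    qhDist U x y ≤ qhLength U L γ :=
  iInf_le_of_le L (iInf_le_of_le γ (iInf_le_of_le h le_rfl))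

theorem exists_arc_of_qhDist_lt {x y : E} {c : ℝ≥0∞} (h : qhDist U x y < c) :
    ∃ L γ, IsArcFromTo U x y L γ ∧ qhLength U L γ < c := by
  simpa only [qhDist, iInf_lt_iff, exists_prop] using h

/-- An arc parametrized by arc length on an arbitrary interval bounds the quasihyperbolic distance
of its endpoints. -/
theorem qhDist_le_lintegral {γ : ℝ → E} {a b : ℝ} (hab : a ≤ b)
    (hu : HasUnitSpeedOn γ (Icc a b)) (hi : InjOn γ (Icc a b)) (hm : MapsTo γ (Icc a b) U) :
    qhDist U (γ a) (γ b) ≤ ∫⁻ t in Icc a b, (bdryDist U (γ t) : ℝ≥0∞)⁻¹ := by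
  have hmem : ∀ t ∈ Icc 0 (b - a), a + t ∈ Icc a b := fun t ht =>
    ⟨by linarith [ht.1], by linarith [ht.2]⟩
  have harc : IsArcFromTo U (γ a) (γ b) (b - a) (fun t => γ (a + t)) :=
    { length_nonneg := sub_nonneg.2 hab
      unitSpeed := by simpa using hu.comp_const_add a
      injOn := fun s hs t ht hst => by simpa using hi (hmem s hs) (hmem t ht) hst
      mapsTo := fun t ht => hm (hmem t ht)
      source := by simp
      target := by simp }
  refine (qhDist_le_qhLength harc).trans_eq ?_
  have hpre : (fun t => a + t) ⁻¹' Icc a b = Icc 0 (b - a) := by simp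
  have := (measurePreserving_add_left volume a).setLIntegral_comp_preimage_emb
    (measurableEmbedding_addLeft a) (fun t => (bdryDist U (γ t) : ℝ≥0∞)⁻¹) (Icc a b)
  rw [hpre] at this
  exact this

/-- As `qhDist_le_lintegral`, with the arc traversed backwards. -/
theorem qhDist_le_lintegral_reverse {γ : ℝ → E} {a b : ℝ} (hab : a ≤ b)
    (hu : HasUnitSpeedOn γ (Icc a b)) (hi : InjOn γ (Icc a b)) (hm : MapsTo γ (Icc a b) U) :
    qhDist U (γ b) (γ a) ≤ ∫⁻ t in Icc a b, (bdryDist U (γ t) : ℝ≥0∞)⁻¹ := by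
  have hmem : ∀ t ∈ Icc 0 (b - a), b - t ∈ Icc a b := fun t ht =>
    ⟨by linarith [ht.2], by linarith [ht.1]⟩
  have harc : IsArcFromTo U (γ b) (γ a) (b - a) (fun t => γ (b - t)) :=
    { length_nonneg := sub_nonneg.2 hab
      unitSpeed := by simpa using hu.comp_const_sub b
      injOn := fun s hs t ht hst => by simpa using hi (hmem s hs) (hmem t ht) hst
      mapsTo := fun t ht => hm (hmem t ht)
      source := by simp
      target := by simp }
  refine (qhDist_le_qhLength harc).trans_eq ?_
  have hpre : (fun t => b - t) ⁻¹' Icc a b = Icc 0 (b - a) := by simp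
  have := (volume.measurePreserving_sub_left b).setLIntegral_comp_preimage_emb
    (MeasurableEquiv.subLeft b).measurableEmbedding
    (fun t => (bdryDist U (γ t) : ℝ≥0∞)⁻¹) (Icc a b)
  rw [hpre] at this
  exact this

theorem qhDist_comm (U : Set E) (x y : E) : qhDist U x y = qhDist U y x := by
  suffices h : ∀ x y, qhDist U x y ≤ qhDist U y x from le_antisymm (h x y) (h y x)
  intro x y
  refine le_iInf fun L => le_iInf fun γ => le_iInf fun h => ?_
  have := qhDist_le_lintegral_reverse h.length_nonneg h.unitSpeed h.injOn h.mapsTo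
  rwa [h.source, h.target] at this

theorem qhDist_self {x : E} (hx : x ∈ U) : qhDist U x x = 0 := by
  have h : IsArcFromTo U x x 0 (fun _ => x) :=
    { length_nonneg := le_rfl
      unitSpeed := hasConstantSpeedOnWith_of_subsingleton _ (by simp) _
      injOn := by simp
      mapsTo := fun _ _ => hx
      source := rfl
      target := rfl }
  refine le_antisymm ((qhDist_le_qhLength h).trans_eq ?_) zero_le
  simp [qhLength]

/-- The triangle inequality. Two arcs with a common endpoint need not concatenate to an arc; the
first one is left at its first meeting point with the second. -/
theorem qhDist_triangle (U : Set E) (x y z : E) :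
    qhDist U x z ≤ qhDist U x y + qhDist U y z := by
  unfold qhDist
  simp only [ENNReal.iInf_add, ENNReal.add_iInf]
  refine le_iInf fun L₂ => le_iInf fun γ₂ => le_iInf fun h₂ => le_iInf fun L₁ => le_iInf fun γ₁ =>
    le_iInf fun h₁ => ?_
  change qhDist U x z ≤ qhLength U L₁ γ₁ + qhLength U L₂ γ₂
  have hK : IsCompact (γ₂ '' Icc 0 L₂) := isCompact_Icc.image_of_continuousOn
    h₂.unitSpeed.continuousOn
  have hS : IsCompact (Icc 0 L₁ ∩ γ₁ ⁻¹' (γ₂ '' Icc 0 L₂)) :=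
    isCompact_Icc.of_isClosed_subset
      (h₁.unitSpeed.continuousOn.preimage_isClosed_of_isClosed isClosed_Icc hK.isClosed)
      inter_subset_left
  obtain ⟨s, ⟨hs, u, hu, hus⟩, hmin⟩ := hS.exists_isLeast
    ⟨L₁, right_mem_Icc.2 h₁.length_nonneg, 0, left_mem_Icc.2 h₂.length_nonneg, by
      rw [h₂.source, h₁.target]⟩
  have hfirst : ∀ t ∈ Icc 0 L₁, t < s → ∀ v ∈ Icc 0 L₂, γ₁ t ≠ γ₂ v := fun t ht hts v hv h =>
    hts.not_ge (hmin ⟨ht, v, hv, h.symm⟩)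
  set γ : ℝ → E := fun t => if t ≤ s then γ₁ t else γ₂ (u - s + t) with hγ
  have e₁ : EqOn γ γ₁ (Icc 0 s) := fun t ht => if_pos ht.2
  have e₂ : EqOn γ (fun t => γ₂ (u - s + t)) (Icc s (s + L₂ - u)) := fun t ht => by
    rcases ht.1.eq_or_lt with rfl | h
    · simp [hγ, hus]
    · simp [hγ, h]
  have hsL : s ≤ s + L₂ - u := by linarith [hu.2]
  have m₁ : ∀ t ∈ Icc 0 s, t ∈ Icc 0 L₁ := fun t ht => ⟨ht.1, ht.2.trans hs.2⟩
  have m₂ : ∀ t ∈ Icc s (s + L₂ - u), u - s + t ∈ Icc 0 L₂ := fun t ht =>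
    ⟨by linarith [ht.1, hu.1], by linarith [ht.2]⟩
  have cover : Icc 0 (s + L₂ - u) = Icc 0 s ∪ Icc s (s + L₂ - u) :=
    (Icc_union_Icc_eq_Icc hs.1 hsL).symm
  have hspeed : HasUnitSpeedOn γ (Icc 0 (s + L₂ - u)) := by
    refine HasUnitSpeedOn.Icc_Icc (y := s) ((h₁.unitSpeed.mono_Icc le_rfl hs.2).congr e₁)
      (HasUnitSpeedOn.congr ?_ e₂)
    refine (h₂.unitSpeed.comp_const_add (u - s)).mono_Icc ?_ ?_ <;> linarith [hu.1]
  have hinj : InjOn γ (Icc 0 (s + L₂ - u)) := by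
    have key : ∀ t ∈ Icc 0 (s + L₂ - u), ∀ t' ∈ Icc 0 (s + L₂ - u), t ≤ t' → γ t = γ t' →
        t = t' := by
      intro t ht t' ht' htt h
      rcases le_total t' s with h1 | h1
      · rw [e₁ ⟨ht.1, htt.trans h1⟩, e₁ ⟨ht'.1, h1⟩] at h
        exact h₁.injOn (m₁ _ ⟨ht.1, htt.trans h1⟩) (m₁ _ ⟨ht'.1, h1⟩) h
      · rcases lt_or_ge t s with h2 | h2
        · rw [e₁ ⟨ht.1, h2.le⟩, e₂ ⟨h1, ht'.2⟩] at h
          exact absurd h (hfirst t (m₁ _ ⟨ht.1, h2.le⟩) h2 _ (m₂ _ ⟨h1, ht'.2⟩))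
        · rw [e₂ ⟨h2, ht.2⟩, e₂ ⟨h1, ht'.2⟩] at h
          simpa using h₂.injOn (m₂ _ ⟨h2, ht.2⟩) (m₂ _ ⟨h1, ht'.2⟩) h
    intro t ht t' ht' h
    rcases le_total t t' with h1 | h1
    · exact key t ht t' ht' h1 h
    · exact (key t' ht' t ht h1 h.symm).symm
  have hmaps : MapsTo γ (Icc 0 (s + L₂ - u)) U := by
    rw [cover]
    rintro t (ht | ht)
    · rw [e₁ ht]; exact h₁.mapsTo (m₁ t ht)
    · rw [e₂ ht]; exact h₂.mapsTo (m₂ t ht)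
  have h0 : γ 0 = x := by rw [e₁ (left_mem_Icc.2 hs.1), h₁.source]
  have hL : γ (s + L₂ - u) = z := by
    rw [e₂ (right_mem_Icc.2 hsL), ← h₂.target]
    exact congrArg γ₂ (by ring)
  have := qhDist_le_lintegral (hs.1.trans hsL) hspeed hinj hmaps
  rw [h0, hL, cover] at this
  refine this.trans ((lintegral_union_le _ _ _).trans (add_le_add ?_ ?_))
  · rw [setLIntegral_congr_fun measurableSet_Icc (fun t ht => by rw [e₁ ht])]
    exact lintegral_mono_set (Icc_subset_Icc_right hs.2)
  · rw [setLIntegral_congr_fun measurableSet_Icc (fun t ht => by rw [e₂ ht])]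
    have hpre : (fun t => u - s + t) ⁻¹' Icc u L₂ = Icc s (s + L₂ - u) := by
      rw [preimage_const_add_Icc]; congr 1 <;> ring
    have h3 := (measurePreserving_add_left volume (u - s)).setLIntegral_comp_preimage_emb
      (measurableEmbedding_addLeft (u - s)) (fun t => (bdryDist U (γ₂ t) : ℝ≥0∞)⁻¹) (Icc u L₂)
    rw [hpre] at h3
    rw [h3]
    exact lintegral_mono_set (Icc_subset_Icc_left hu.1)

theorem exists_isPreconnected_of_qhDist_ne_top {x y : E} (h : qhDist U x y ≠ ⊤) :
    ∃ t ⊆ U, x ∈ t ∧ y ∈ t ∧ IsPreconnected t := by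
  obtain ⟨L, γ, hγ, -⟩ := exists_arc_of_qhDist_lt h.lt_top
  exact ⟨γ '' Icc 0 L, hγ.mapsTo.image_subset,
    ⟨0, left_mem_Icc.2 hγ.length_nonneg, hγ.source⟩,
    ⟨L, right_mem_Icc.2 hγ.length_nonneg, hγ.target⟩,
    isPreconnected_Icc.image γ hγ.unitSpeed.continuousOn⟩

theorem qhDist_anti {V : Set E} (hVU : V ⊆ U) (h : ∀ z ∈ V, bdryDist V z ≤ bdryDist U z)
    (x y : E) : qhDist U x y ≤ qhDist V x y := by
  refine le_iInf fun L => le_iInf fun γ => le_iInf fun hγ => ?_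
  refine (qhDist_le_qhLength { hγ with mapsTo := fun t ht => hVU (hγ.mapsTo ht) }).trans ?_
  exact setLIntegral_mono' measurableSet_Icc fun t ht =>
    ENNReal.inv_le_inv.2 (by exact_mod_cast h _ (hγ.mapsTo ht))

end QhDist

/-! ### Elementary estimates of the quasihyperbolic distance -/

section Estimates

variable {E : Type*} [NormedAddCommGroup E] {U : Set E}

theorem bdryDist_pos (hU : IsOpen U) (hne : (frontier U).Nonempty) {z : E} (hz : z ∈ U) :
    0 < (bdryDist U z : ℝ) := by
  refine (isClosed_frontier.notMem_iff_infDist_pos hne).1 fun h => ?_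
  rw [hU.frontier_eq] at h
  exact h.2 hz

theorem bdryDist_le_add_dist (U : Set E) (x y : E) :
    (bdryDist U x : ℝ) ≤ bdryDist U y + dist x y :=
  infDist_le_infDist_add_dist

theorem lintegral_inv_add {d L : ℝ} (hd : 0 < d) (hL : 0 ≤ L) :
    ∫⁻ t in Icc 0 L, (ENNReal.ofReal (d + t))⁻¹ = ENNReal.ofReal (Real.log (1 + L / d)) := by
  have hpos : ∀ t ∈ Icc 0 L, 0 < d + t := fun t ht => by linarith [ht.1]
  have hcont : ContinuousOn (fun t => (d + t)⁻¹) (Icc 0 L) :=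
    (continuousOn_const.add continuousOn_id).inv₀ fun t ht => (hpos t ht).ne'
  rw [setLIntegral_congr_fun measurableSet_Icc
    (fun t ht => (ENNReal.ofReal_inv_of_pos (hpos t ht)).symm),
    ← ofReal_integral_eq_lintegral_ofReal hcont.integrableOn_Icc
    ((ae_restrict_iff' measurableSet_Icc).2 (.of_forall fun t ht => (inv_pos.2 (hpos t ht)).le))]
  rw [integral_Icc_eq_integral_Ioc, ← intervalIntegral.integral_of_le hL,
    intervalIntegral.integral_comp_add_left (fun t => t⁻¹), integral_inv_of_pos (by linarith)
    (by linarith)]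
  congr 2
  field_simp
  ring

/-- The distance to the boundary grows at most at unit rate along an arc. -/
theorem log_le_qhDist {x : E} (hx : 0 < bdryDist U x) (y : E) :
    ENNReal.ofReal (Real.log (1 + dist x y / bdryDist U x)) ≤ qhDist U x y := by
  refine le_iInf fun L => le_iInf fun γ => le_iInf fun h => ?_
  have hx' : (0 : ℝ) < bdryDist U x := hx
  have hL : dist x y ≤ L := by
    have := h.unitSpeed.dist_le (left_mem_Icc.2 h.length_nonneg) (right_mem_Icc.2 h.length_nonneg)
    rwa [h.source, h.target, zero_sub, abs_neg, abs_of_nonneg h.length_nonneg] at this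
  calc _ ≤ ENNReal.ofReal (Real.log (1 + L / bdryDist U x)) := by gcongr
    _ = ∫⁻ t in Icc 0 L, (ENNReal.ofReal (bdryDist U x + t))⁻¹ :=
      (lintegral_inv_add hx' h.length_nonneg).symm
    _ ≤ _ := by
      refine setLIntegral_mono' measurableSet_Icc fun t ht => ENNReal.inv_le_inv.2 ?_
      rw [← ENNReal.ofReal_coe_nnreal]
      refine ENNReal.ofReal_le_ofReal ((bdryDist_le_add_dist U _ x).trans ?_)
      have := h.unitSpeed.dist_le ht (left_mem_Icc.2 h.length_nonneg)
      rw [h.source, sub_zero, abs_of_nonneg ht.1] at this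
      gcongr

variable [NormedSpace ℝ E]

theorem IsProperDomain.frontier_nonempty (hU : IsProperDomain U) : (frontier U).Nonempty :=
  nonempty_frontier_iff.2 ⟨hU.isConnected.nonempty, hU.ne_univ⟩

theorem IsProperDomain.bdryDist_pos (hU : IsProperDomain U) {z : E} (hz : z ∈ U) :
    0 < (bdryDist U z : ℝ) :=
  _root_.bdryDist_pos hU.isOpen hU.frontier_nonempty hz

theorem ball_bdryDist_subset (hU : IsOpen U) {z : E} (hz : z ∈ U) :
    ball z (bdryDist U z) ⊆ U := by
  rcases (ball z (bdryDist U z : ℝ)).eq_empty_or_nonempty with h0 | h0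
  · simp [h0]
  have hz' : z ∈ ball z (bdryDist U z : ℝ) := mem_ball_self (nonempty_ball.1 h0)
  refine (isPreconnected_ball (x := z) (r := (bdryDist U z : ℝ))).subset_left_of_subset_union hU
    isClosed_closure.isOpen_compl (disjoint_compl_right_iff_subset.2 subset_closure)
    (fun w hw => ?_) ⟨z, hz', hz⟩
  by_contra hcon
  simp only [mem_union, mem_compl_iff, not_or, not_not] at hcon
  have hw' : w ∈ frontier U := by rw [hU.frontier_eq]; exact ⟨hcon.2, hcon.1⟩
  have : (bdryDist U z : ℝ) ≤ dist z w := infDist_le_dist_of_mem hw'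
  rw [dist_comm] at this
  exact absurd (mem_ball.1 hw) this.not_gt

/-- The straight segment from `a` in the direction of a unit vector `e`. -/
theorem qhDist_add_smul_le {a e : E} (he : ‖e‖ = 1) {L : ℝ} (hL : 0 ≤ L)
    (hm : ∀ t ∈ Icc 0 L, a + t • e ∈ U) :
    qhDist U a (a + L • e) ≤ ∫⁻ t in Icc 0 L, (bdryDist U (a + t • e) : ℝ≥0∞)⁻¹ := by
  have hiso : Isometry (fun t : ℝ => a + t • e) := Isometry.of_dist_eq fun s t => by
    rw [dist_add_left, dist_eq_norm, ← sub_smul, norm_smul, he, mul_one, Real.dist_eq,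
      Real.norm_eq_abs]
  have := qhDist_le_lintegral hL (hiso.hasUnitSpeedOn _) hiso.injective.injOn hm
  simpa using this

theorem qhDist_le_of_segment {a b : E} {m : ℝ} (hm : 0 < m)
    (h : ∀ z ∈ segment ℝ a b, z ∈ U ∧ m ≤ bdryDist U z) :
    qhDist U a b ≤ ENNReal.ofReal (dist a b / m) := by
  rcases eq_or_ne a b with rfl | hab
  · rw [qhDist_self (h a (left_mem_segment ..)).1]; exact zero_le
  have hL : 0 < dist a b := dist_pos.2 hab
  set e : E := (dist a b)⁻¹ • (b - a) with he
  have hen : ‖e‖ = 1 := by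
    rw [he, norm_smul, norm_inv, Real.norm_of_nonneg hL.le, ← dist_eq_norm, dist_comm b a,
      inv_mul_cancel₀ hL.ne']
  have hseg : ∀ t ∈ Icc 0 (dist a b), a + t • e ∈ segment ℝ a b := fun t ht => by
    rw [segment_eq_image']
    exact ⟨t * (dist a b)⁻¹, ⟨by have := ht.1; positivity, by
      rw [← div_eq_mul_inv]; exact (div_le_one hL).2 ht.2⟩, by simp [he, mul_smul]⟩
  have hb : a + dist a b • e = b := by
    rw [he, smul_smul, mul_inv_cancel₀ hL.ne', one_smul]; abel
  have := qhDist_add_smul_le hen hL.le (fun t ht => (h _ (hseg t ht)).1)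
  rw [hb] at this
  refine this.trans ?_
  calc _ ≤ ∫⁻ _ in Icc 0 (dist a b), (ENNReal.ofReal m)⁻¹ := by
        refine setLIntegral_mono' measurableSet_Icc fun t ht => ENNReal.inv_le_inv.2 ?_
        rw [← ENNReal.ofReal_coe_nnreal]
        exact ENNReal.ofReal_le_ofReal (h _ (hseg t ht)).2
    _ = _ := by
        rw [setLIntegral_const, Real.volume_Icc, sub_zero, div_eq_mul_inv, mul_comm,
          ENNReal.ofReal_mul hL.le, ENNReal.ofReal_inv_of_pos hm]

theorem qhDist_le_of_dist_lt (hU : IsOpen U) {a b : E} (ha : a ∈ U)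
    (hab : dist a b < bdryDist U a) :
    qhDist U a b ≤ ENNReal.ofReal (dist a b / (bdryDist U a - dist a b)) := by
  refine qhDist_le_of_segment (sub_pos.2 hab) fun z hz => ?_
  have hz' : dist a z ≤ dist a b := by
    have := (convex_closedBall a (dist a b)).segment_subset
      (mem_closedBall_self dist_nonneg) (mem_closedBall.2 (dist_comm b a).le) hz
    rwa [mem_closedBall, dist_comm] at this
  refine ⟨ball_bdryDist_subset hU ha (mem_ball.2 (by rw [dist_comm]; linarith)), ?_⟩
  linarith [bdryDist_le_add_dist U a z]

theorem qhDist_le_of_dist_le_half (hU : IsOpen U) {a b : E} (ha : a ∈ U)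
    (hd : 0 < (bdryDist U a : ℝ)) (hab : dist a b ≤ bdryDist U a / 2) :
    qhDist U a b ≤ ENNReal.ofReal (2 * (dist a b / bdryDist U a)) := by
  refine (qhDist_le_of_dist_lt hU ha (by linarith)).trans (ENNReal.ofReal_le_ofReal ?_)
  rw [← mul_div_assoc, div_le_div_iff₀ (by linarith) hd]
  nlinarith [dist_nonneg (x := a) (y := b)]

/-- The point `w` cuts an arc of quasihyperbolic length less than `(n + 1) * h` in the proportion
`n : 1`; it exists by the intermediate value theorem. -/
theorem exists_qhDist_lt_qhDist_lt (hU : IsProperDomain U) {p q : E} {n : ℕ} (hn : 1 ≤ n)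
    {h : ℝ} (hh : 0 < h) (hpq : qhDist U p q < ENNReal.ofReal ((n + 1) * h)) :
    ∃ w ∈ U, qhDist U p w < ENNReal.ofReal (n * h) ∧ qhDist U w q < ENNReal.ofReal h := by
  obtain ⟨L, γ, hγ, hlt⟩ := exists_arc_of_qhDist_lt hpq
  have hL := hγ.length_nonneg
  set ρ : ℝ → ℝ := fun t => (bdryDist U (γ t) : ℝ)⁻¹ with hρ
  have hpos : ∀ t ∈ Icc 0 L, 0 < (bdryDist U (γ t) : ℝ) := fun t ht =>
    hU.bdryDist_pos (hγ.mapsTo ht)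
  have hcont : ContinuousOn ρ (Icc 0 L) := by
    refine ContinuousOn.inv₀ ?_ fun t ht => (hpos t ht).ne'
    exact (NNReal.continuous_coe.comp (continuous_bdryDist U)).comp_continuousOn
      hγ.unitSpeed.continuousOn
  have hint : ∀ a b, 0 ≤ a → b ≤ L → IntegrableOn ρ (Icc a b) := fun a b ha hb =>
    (hcont.mono (Icc_subset_Icc ha hb)).integrableOn_Icc
  have hlint : ∀ a b, 0 ≤ a → a ≤ b → b ≤ L →
      ∫⁻ t in Icc a b, (bdryDist U (γ t) : ℝ≥0∞)⁻¹ = ENNReal.ofReal (∫ t in a..b, ρ t) := by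
    intro a b ha hab hb
    have hsub : ∀ t ∈ Icc a b, t ∈ Icc 0 L := fun t ht => Icc_subset_Icc ha hb ht
    rw [intervalIntegral.integral_of_le hab, ← integral_Icc_eq_integral_Ioc,
      ofReal_integral_eq_lintegral_ofReal (hint a b ha hb) ((ae_restrict_iff' measurableSet_Icc).2
        (.of_forall fun t ht => (inv_pos.2 (hpos t (hsub t ht))).le))]
    refine setLIntegral_congr_fun measurableSet_Icc fun t ht => ?_
    simp only [hρ]
    rw [ENNReal.ofReal_inv_of_pos (hpos t (hsub t ht)), ENNReal.ofReal_coe_nnreal]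
  have hii : ∀ a b, 0 ≤ a → a ≤ b → b ≤ L → IntervalIntegrable ρ volume a b :=
    fun a b ha hab hb => (intervalIntegrable_iff_integrableOn_Icc_of_le hab).2 (hint a b ha hb)
  set K : ℝ := ∫ t in 0..L, ρ t with hK
  have hK0 : 0 ≤ K := intervalIntegral.integral_nonneg hL fun t ht => (inv_pos.2 (hpos t ht)).le
  have hKlt : K < (n + 1) * h := by
    rw [qhLength, hlint 0 L le_rfl hL le_rfl] at hlt
    exact (ENNReal.ofReal_lt_ofReal_iff (by positivity)).1 hlt
  have hn' : (0 : ℝ) < n := by exact_mod_cast hn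
  obtain ⟨s, hs, hsK⟩ : K * (n / (n + 1)) ∈ (fun x => ∫ t in 0..x, ρ t) '' Icc 0 L := by
    refine intermediate_value_Icc hL ?_ ⟨?_, ?_⟩
    · have := intervalIntegral.continuousOn_primitive_interval (a := 0) (b := L) (f := ρ)
        (μ := volume) (by rw [uIcc_of_le hL]; exact hint 0 L le_rfl le_rfl)
      rwa [uIcc_of_le hL] at this
    · simp only [intervalIntegral.integral_same]; positivity
    · exact mul_le_of_le_one_right hK0 ((div_le_one (by positivity)).2 (by linarith))
  have hsK' : ∫ t in 0..s, ρ t = K * (n / (n + 1)) := hsK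
  have hsL : ∫ t in s..L, ρ t = K * (1 / (n + 1)) := by
    have := intervalIntegral.integral_add_adjacent_intervals (hii 0 s le_rfl hs.1 hs.2)
      (hii s L hs.1 hs.2 le_rfl)
    rw [hsK', ← hK] at this
    have h2 : K = K * (n / (n + 1)) + K * (1 / (n + 1)) := by field_simp
    linarith
  refine ⟨γ s, hγ.mapsTo hs, ?_, ?_⟩
  · have := qhDist_le_lintegral (U := U) hs.1 (hγ.unitSpeed.mono_Icc le_rfl hs.2)
      (hγ.injOn.mono (Icc_subset_Icc_right hs.2)) (hγ.mapsTo.mono_left (Icc_subset_Icc_right hs.2))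
    rw [hγ.source, hlint 0 s le_rfl hs.1 hs.2, hsK'] at this
    refine this.trans_lt ((ENNReal.ofReal_lt_ofReal_iff (by positivity)).2 ?_)
    calc K * (n / (n + 1)) < (n + 1) * h * (n / (n + 1)) := by gcongr
      _ = n * h := by field_simp
  · have := qhDist_le_lintegral (U := U) hs.2 (hγ.unitSpeed.mono_Icc hs.1 le_rfl)
      (hγ.injOn.mono (Icc_subset_Icc_left hs.1)) (hγ.mapsTo.mono_left (Icc_subset_Icc_left hs.1))
    rw [hγ.target, hlint s L hs.1 hs.2 le_rfl, hsL] at this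
    refine this.trans_lt ((ENNReal.ofReal_lt_ofReal_iff hh).2 ?_)
    calc K * (1 / (n + 1)) < (n + 1) * h * (1 / (n + 1)) := by gcongr
      _ = h := by field_simp

end Estimates

/-! ### Lower bound for the control function of a uniform domain -/

section Psi

theorem strictMono_nnreal_homeomorph (ψ : ℝ≥0 ≃ₜ ℝ≥0) : StrictMono ψ := by
  refine (ψ.continuous.strictMono_of_inj ψ.injective).resolve_right fun h => ?_
  obtain ⟨x, hx⟩ := ψ.surjective (ψ 0 + 1)
  have := h.antitone (zero_le : 0 ≤ x)
  rw [hx] at this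
  exact absurd this (by simp)

variable {E : Type*} [NormedAddCommGroup E] [NormedSpace ℝ E] {U : Set E}

/-- Every `t ≥ 0` is a relative distance in `U`: fix one of the points and let the other one run
towards the boundary. The lower bound `log_le_qhDist` for that pair of points is one for `ψ t`. -/
theorem IsPsiUniform.log_le {ψ : ℝ≥0 ≃ₜ ℝ≥0} (h : IsPsiUniform ψ U) (t : ℝ≥0) :
    Real.log (1 + t) ≤ ψ t := by
  have hU := h.domain
  obtain ⟨z₀, hz₀⟩ := hU.isConnected.nonempty
  have hd₀ := hU.bdryDist_pos hz₀
  have hpos : ∀ z ∈ U, 0 < min (bdryDist U z₀) (bdryDist U z) := fun z hz =>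
    lt_min hd₀ (hU.bdryDist_pos hz)
  set f : E → ℝ≥0 := fun z => nndist z₀ z / min (bdryDist U z₀) (bdryDist U z) with hf
  have hfc : ContinuousOn f U := by
    refine ContinuousOn.div ?_ ?_ fun z hz => (hpos z hz).ne'
    · exact (continuous_const.nndist continuous_id).continuousOn
    · exact (continuous_const.min (continuous_bdryDist U)).continuousOn
  obtain ⟨w, hw⟩ := hU.frontier_nonempty
  obtain ⟨y, hy, hty⟩ : ∃ y ∈ U, t ≤ f y := by
    set d : ℝ := (bdryDist U z₀ : ℝ) with hd
    have hε : 0 < min (d / 2) (d / (2 * (t + 1))) := by positivity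
    obtain ⟨y, hy, hyw⟩ := Metric.mem_closure_iff.1 (frontier_subset_closure hw) _ hε
    refine ⟨y, hy, ?_⟩
    have h1 : d ≤ dist z₀ w := infDist_le_dist_of_mem hw
    have h2 : (bdryDist U y : ℝ) ≤ dist y w := infDist_le_dist_of_mem hw
    have h3 : dist z₀ w ≤ dist z₀ y + dist y w := dist_triangle ..
    rw [dist_comm w y] at hyw
    have h4 := hyw.trans_le (min_le_left ..)
    have h5 := hyw.trans_le (min_le_right ..)
    rw [lt_div_iff₀ (by positivity)] at h5
    have hb := hU.bdryDist_pos hy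
    simp only [hf]
    rw [le_div_iff₀ (hpos y hy)]
    refine (mul_le_mul_right (min_le_right (bdryDist U z₀) (bdryDist U y)) t).trans ?_
    rw [← NNReal.coe_le_coe, NNReal.coe_mul, coe_nndist]
    have : (t : ℝ) * bdryDist U y ≤ t * dist y w := by gcongr
    nlinarith [dist_nonneg (x := y) (y := w)]
  obtain ⟨z, hz, rfl⟩ := hU.isConnected.isPreconnected.intermediate_value hz₀ hy hfc
    (show t ∈ Icc (f z₀) (f y) from ⟨by simp [hf], hty⟩)
  have hk := h.qhDist_le z₀ hz₀ z hz
  have hlow : ENNReal.ofReal (Real.log (1 + f z)) ≤ qhDist U z₀ z := by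
    rcases le_total (bdryDist U z₀) (bdryDist U z) with hle | hle
    · simpa [hf, min_eq_left hle] using log_le_qhDist hd₀ z
    · rw [qhDist_comm]
      have := log_le_qhDist (hU.bdryDist_pos hz) z₀
      simpa [hf, min_eq_right hle, dist_comm z z₀] using this
  have := hlow.trans hk
  rwa [← ENNReal.ofReal_coe_nnreal, ENNReal.ofReal_le_ofReal_iff NNReal.zero_le_coe] at this

end Psi

/-! ### Quasihyperbolic distance in a punctured ball -/

section PuncturedBall

variable {E : Type*} [NormedAddCommGroup E] [NormedSpace ℝ E] {U : Set E} {x : E} {r : ℝ}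

theorem qhDist_radial_le (hr : ∀ z, z ≠ x → dist z x < r → z ∈ U ∧ dist z x ≤ bdryDist U z)
    {e : E} (he : ‖e‖ = 1) {s R : ℝ} (hs : 0 < s) (hsR : s ≤ R) (hR : R < r) :
    qhDist U (x + s • e) (x + R • e) ≤ ENNReal.ofReal (Real.log (R / s)) := by
  have hz : ∀ t ∈ Icc 0 (R - s), x + s • e + t • e ∈ U ∧
      s + t ≤ bdryDist U (x + s • e + t • e) := by
    intro t ht
    have hst : 0 < s + t := by linarith [ht.1]
    have hd : dist (x + s • e + t • e) x = s + t := by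
      rw [dist_eq_norm, add_assoc, add_sub_cancel_left, ← add_smul, norm_smul, he, mul_one,
        Real.norm_of_nonneg hst.le]
    have := hr _ (dist_pos.1 (hd ▸ hst)) (by rw [hd]; linarith [ht.2])
    rwa [hd] at this
  have h1 := qhDist_add_smul_le he (sub_nonneg.2 hsR) fun t ht => (hz t ht).1
  have h2 : x + s • e + (R - s) • e = x + R • e := by rw [sub_smul]; abel
  rw [h2] at h1
  refine h1.trans ?_
  calc _ ≤ ∫⁻ t in Icc 0 (R - s), (ENNReal.ofReal (s + t))⁻¹ := by
        refine setLIntegral_mono' measurableSet_Icc fun t ht => ENNReal.inv_le_inv.2 ?_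
        rw [← ENNReal.ofReal_coe_nnreal]
        exact ENNReal.ofReal_le_ofReal (hz t ht).2
    _ = ENNReal.ofReal (Real.log (R / s)) := by
        rw [lintegral_inv_add hs (sub_nonneg.2 hsR)]
        congr 2
        field_simp
        ring

/-- A chord of a sphere around the puncture that keeps a quarter of the radius away from the
centre. -/
theorem qhDist_chord_le (hr : ∀ z, z ≠ x → dist z x < r → z ∈ U ∧ dist z x ≤ bdryDist U z)
    {u v : E} {R : ℝ} (hR : 0 < R) (hRr : R < r) (hu : ‖u‖ = R) (hv : ‖v‖ = R)
    (h : ∀ s ∈ Icc (0 : ℝ) 1, R / 4 ≤ ‖(1 - s) • u + s • v‖) :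
    qhDist U (x + u) (x + v) ≤ ENNReal.ofReal 8 := by
  refine (qhDist_le_of_segment (m := R / 4) (by positivity) ?_).trans
    (ENNReal.ofReal_le_ofReal ?_)
  · rw [segment_eq_image]
    rintro _ ⟨s, hs, rfl⟩
    have h1 : (1 - s) • (x + u) + s • (x + v) = x + ((1 - s) • u + s • v) := by module
    have h2 : dist (x + ((1 - s) • u + s • v)) x = ‖(1 - s) • u + s • v‖ := by
      simp [dist_eq_norm]
    have h3 : ‖(1 - s) • u + s • v‖ ≤ R := by
      have := (convex_closedBall (0 : E) R) (mem_closedBall_zero_iff.2 hu.le)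
        (mem_closedBall_zero_iff.2 hv.le) (sub_nonneg.2 hs.2) hs.1 (by ring)
      exact mem_closedBall_zero_iff.1 this
    have h4 := h s hs
    simp only [h1]
    have h5 := hr (x + ((1 - s) • u + s • v)) (dist_pos.1 (by rw [h2]; linarith))
      (by rw [h2]; linarith)
    rw [h2] at h5
    exact ⟨h5.1, h4.trans h5.2⟩
  · rw [dist_add_left, div_le_iff₀ (by positivity)]
    have := dist_le_norm_add_norm u v
    linarith

/-- A vector that is almost orthogonal to a given one in the sense of Riesz's lemma. -/
theorem exists_norm_eq_forall_le_norm_sub_smul (hE : 2 ≤ Module.rank ℝ E) {u : E} {R : ℝ}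
    (hR : 0 < R) (hu : ‖u‖ = R) :
    ∃ c : E, ‖c‖ = R ∧ ∀ t : ℝ, 3 / 4 * R ≤ ‖c - t • u‖ := by
  have hu0 : u ≠ 0 := norm_pos_iff.1 (hu ▸ hR)
  obtain ⟨y, hy⟩ := exists_linearIndependent_pair_of_one_lt_rank (R := ℝ)
    (lt_of_lt_of_le (by norm_num) hE) hu0
  have hF : ∃ w, w ∉ Submodule.span ℝ {u} := by
    refine ⟨y, fun hmem => ?_⟩
    obtain ⟨t, rfl⟩ := Submodule.mem_span_singleton.1 hmem
    have := LinearIndependent.pair_iff.1 hy t (-1) (by simp)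
    norm_num at this
  obtain ⟨c, -, hc, hcF⟩ := riesz_lemma_of_lt_one (𝕜 := ℝ)
    (Submodule.span ℝ {u}).closed_of_finiteDimensional hF (show (3 / 4 : ℝ) < 1 by norm_num)
  refine ⟨R • c, by rw [norm_smul, hc, mul_one, Real.norm_of_nonneg hR.le], fun t => ?_⟩
  have h1 := hcF ((t / R) • u) (Submodule.smul_mem _ _ (Submodule.mem_span_singleton_self u))
  have h2 : R • c - t • u = R • (c - (t / R) • u) := by
    rw [smul_sub, smul_smul, mul_div_cancel₀ _ hR.ne']
  rw [h2, norm_smul, Real.norm_of_nonneg hR.le]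
  nlinarith

theorem le_norm_combination_of_riesz {u c : E} {R : ℝ} (hR : 0 < R) (hu : ‖u‖ = R)
    (hc : ‖c‖ = R) (h : ∀ t : ℝ, 3 / 4 * R ≤ ‖c - t • u‖) {s : ℝ} (hs : s ∈ Icc (0 : ℝ) 1) :
    R / 4 ≤ ‖(1 - s) • u + s • c‖ := by
  rcases le_total s (3 / 8) with hs' | hs'
  · have h1 := norm_sub_le_norm_add ((1 - s) • u) (s • c)
    rw [norm_smul, norm_smul, hu, hc, Real.norm_of_nonneg (sub_nonneg.2 hs.2),
      Real.norm_of_nonneg hs.1] at h1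
    nlinarith
  · have hs0 : 0 < s := by linarith
    have h1 : (1 - s) • u + s • c = s • (c - (-((1 - s) / s)) • u) := by
      rw [neg_smul, sub_neg_eq_add, smul_add, smul_smul, mul_div_cancel₀ _ hs0.ne', add_comm]
    rw [h1, norm_smul, Real.norm_of_nonneg hs.1]
    nlinarith [h (-((1 - s) / s))]

theorem le_norm_combination_of_le_norm_add {u c : E} {R : ℝ} (hu : ‖u‖ = R)
    (hc : ‖c‖ = R) (h : R ≤ ‖u + c‖) {s : ℝ} (hs : s ∈ Icc (0 : ℝ) 1) :
    R / 4 ≤ ‖(1 - s) • u + s • c‖ := by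
  have hR : 0 ≤ R := hu ▸ norm_nonneg u
  rcases le_total s (3 / 8) with hs' | hs'
  · have h1 := norm_sub_le_norm_add ((1 - s) • u) (s • c)
    rw [norm_smul, norm_smul, hu, hc, Real.norm_of_nonneg (sub_nonneg.2 hs.2),
      Real.norm_of_nonneg hs.1] at h1
    nlinarith
  rcases le_total (5 / 8) s with hs'' | hs''
  · have h1 := norm_sub_le_norm_add (s • c) ((1 - s) • u)
    rw [norm_smul, norm_smul, hu, hc, Real.norm_of_nonneg (sub_nonneg.2 hs.2),
      Real.norm_of_nonneg hs.1, add_comm (s • c)] at h1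
    nlinarith
  · have h1 : (1 - s) • u + s • c = (1 / 2 : ℝ) • (u + c) + (1 / 2 - s) • (u - c) := by module
    have h2 := norm_sub_le_norm_add ((1 / 2 : ℝ) • (u + c)) ((1 / 2 - s) • (u - c))
    rw [← h1, norm_smul, norm_smul, Real.norm_of_nonneg (by norm_num : (0 : ℝ) ≤ 1 / 2)] at h2
    have h3 : ‖(1 / 2 - s : ℝ)‖ ≤ 1 / 8 := by
      rw [Real.norm_eq_abs, abs_le]; constructor <;> linarith
    have h4 : ‖u - c‖ ≤ 2 * R := (norm_sub_le u c).trans_eq (by rw [hu, hc]; ring)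
    have h5 : ‖(1 / 2 - s : ℝ)‖ * ‖u - c‖ ≤ 1 / 8 * (2 * R) := by gcongr
    linarith

/-- Two points of a sphere around the puncture are joined through a third one, chosen such that
both chords keep away from the centre. -/
theorem qhDist_sphere_le (hE : 2 ≤ Module.rank ℝ E)
    (hr : ∀ z, z ≠ x → dist z x < r → z ∈ U ∧ dist z x ≤ bdryDist U z)
    {u v : E} {R : ℝ} (hR : 0 < R) (hRr : R < r) (hu : ‖u‖ = R) (hv : ‖v‖ = R) :
    qhDist U (x + u) (x + v) ≤ ENNReal.ofReal 16 := by
  obtain ⟨c, hcR, hcu, hcv⟩ : ∃ c : E, ‖c‖ = R ∧ (∀ t : ℝ, 3 / 4 * R ≤ ‖c - t • u‖) ∧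
      R ≤ ‖c + v‖ := by
    obtain ⟨c, hcR, hcu⟩ := exists_norm_eq_forall_le_norm_sub_smul hE hR hu
    rcases le_total R ‖c + v‖ with h | h
    · exact ⟨c, hcR, hcu, h⟩
    -- `c + v` and `-c + v` have difference of norm `2 * R`, so `-c` serves when `c` does not
    · refine ⟨-c, by rwa [norm_neg], fun t => ?_, ?_⟩
      · have := hcu (-t)
        rwa [neg_smul, sub_neg_eq_add, ← norm_neg, neg_add, ← sub_eq_add_neg] at this
      · have h1 := norm_sub_le (c + v) (-c + v)
        have h2 : c + v - (-c + v) = (2 : ℝ) • c := by module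
        rw [h2, norm_smul, hcR, Real.norm_of_nonneg (by norm_num)] at h1
        linarith
  calc _ ≤ qhDist U (x + u) (x + c) + qhDist U (x + c) (x + v) := qhDist_triangle ..
    _ ≤ ENNReal.ofReal 8 + ENNReal.ofReal 8 := add_le_add
        (qhDist_chord_le hr hR hRr hu hcR fun s hs => le_norm_combination_of_riesz hR hu hcR hcu hs)
        (qhDist_chord_le hr hR hRr hcR hv fun s hs =>
          le_norm_combination_of_le_norm_add hcR hv hcv hs)
    _ = ENNReal.ofReal 16 := by
        rw [← ENNReal.ofReal_add (by norm_num) (by norm_num)]; norm_num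

/-- The radial segment from `a` reaches the sphere through `b` at a logarithmic cost; the sphere is
then followed at a bounded one. -/
theorem qhDist_puncturedBall_le (hE : 2 ≤ Module.rank ℝ E)
    (hr : ∀ z, z ≠ x → dist z x < r → z ∈ U ∧ dist z x ≤ bdryDist U z)
    {a b : E} (ha : a ≠ x) (hab : dist a x ≤ dist b x) (hb : dist b x < r) :
    qhDist U a b ≤ ENNReal.ofReal (16 + Real.log (dist b x / dist a x)) := by
  have hs : 0 < dist a x := dist_pos.2 ha
  have hR : 0 < dist b x := hs.trans_le hab
  set e : E := (dist a x)⁻¹ • (a - x) with he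
  have hen : ‖e‖ = 1 := by
    rw [he, norm_smul, norm_inv, Real.norm_of_nonneg hs.le, ← dist_eq_norm,
      inv_mul_cancel₀ hs.ne']
  have hae : x + dist a x • e = a := by
    rw [he, smul_smul, mul_inv_cancel₀ hs.ne', one_smul]; abel
  have hbe : x + (b - x) = b := by abel
  have h1 := qhDist_radial_le hr hen hs hab hb
  have h2 := qhDist_sphere_le hE hr (u := dist b x • e) (v := b - x) hR hb
    (by rw [norm_smul, hen, mul_one, Real.norm_of_nonneg hR.le]) (dist_eq_norm b x).symm
  rw [hae] at h1
  rw [hbe] at h2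
  have hlog : 0 ≤ Real.log (dist b x / dist a x) := Real.log_nonneg ((one_le_div hs).2 hab)
  rw [add_comm, ENNReal.ofReal_add hlog (by norm_num)]
  exact (qhDist_triangle ..).trans (add_le_add h1 h2)

end PuncturedBall

/-! ### Domains with a sparse set of punctures -/

section Sparse

variable {E : Type*} [NormedAddCommGroup E] {D P : Set E}

/-- `P` is a relatively closed subset of `D` whose points are separated by a third of their
distance to the boundary of `D`, and all points of `P` become boundary points of `D \ P`. -/
structure IsSparseIn (P D : Set E) : Prop where
  subset : P ⊆ D
  isOpen_diff : IsOpen (D \ P)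
  frontier_diff : frontier (D \ P) = frontier D ∪ P
  le_dist : ∀ x ∈ P, ∀ y ∈ P, x ≠ y → (bdryDist D x : ℝ) ≤ 3 * dist x y

namespace IsSparseIn

theorem bdryDist_diff_le_dist (hP : IsSparseIn P D) {x : E} (hx : x ∈ P) (z : E) :
    (bdryDist (D \ P) z : ℝ) ≤ dist z x :=
  infDist_le_dist_of_mem (by rw [hP.frontier_diff]; exact Or.inr hx)

variable [NormedSpace ℝ E]

theorem bdryDist_diff_le (hP : IsSparseIn P D) (hD : IsProperDomain D) (z : E) :
    (bdryDist (D \ P) z : ℝ) ≤ bdryDist D z :=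
  infDist_le_infDist_of_subset (by rw [hP.frontier_diff]; exact subset_union_left)
    hD.frontier_nonempty

theorem frontier_diff_nonempty (hP : IsSparseIn P D) (hD : IsProperDomain D) :
    (frontier (D \ P)).Nonempty := by
  rw [hP.frontier_diff]; exact hD.frontier_nonempty.inl

theorem bdryDist_diff_pos (hP : IsSparseIn P D) (hD : IsProperDomain D) {z : E}
    (hz : z ∈ D \ P) : 0 < (bdryDist (D \ P) z : ℝ) :=
  bdryDist_pos hP.isOpen_diff (hP.frontier_diff_nonempty hD) hz

theorem le_bdryDist_diff (hP : IsSparseIn P D) (hD : IsProperDomain D) {z : E} {m : ℝ}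
    (h1 : m ≤ bdryDist D z) (h2 : ∀ x ∈ P, m ≤ dist z x) : m ≤ bdryDist (D \ P) z := by
  refine (le_infDist (hP.frontier_diff_nonempty hD)).2 fun y hy => ?_
  rw [hP.frontier_diff] at hy
  rcases hy with hy | hy
  · exact h1.trans (infDist_le_dist_of_mem hy)
  · exact h2 y hy

/-- Near a puncture `x`, the distance to the boundary of `D \ P` is the distance to `x`. -/
theorem mem_diff_and_dist_le (hP : IsSparseIn P D) (hD : IsProperDomain D) {x : E} (hx : x ∈ P)
    {z : E} (hzx : z ≠ x) (hz : dist z x < bdryDist D x / 6) :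
    z ∈ D \ P ∧ dist z x ≤ bdryDist (D \ P) z := by
  have hd := hD.bdryDist_pos (hP.subset hx)
  have hfar : ∀ y ∈ P, dist z x ≤ dist z y := by
    intro y hy
    rcases eq_or_ne x y with rfl | hxy
    · exact le_rfl
    have h1 := hP.le_dist x hx y hy hxy
    have h2 := dist_triangle x z y
    rw [dist_comm x z] at h2
    linarith
  refine ⟨⟨ball_bdryDist_subset hD.isOpen (hP.subset hx) (mem_ball.2 (by linarith)),
    fun hzP => ?_⟩, hP.le_bdryDist_diff hD ?_ hfar⟩
  · have := hfar z hzP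
    rw [dist_self] at this
    exact (dist_pos.2 hzx).not_ge this
  · have := bdryDist_le_add_dist D x z
    rw [dist_comm x z] at this
    linarith

/-- Every point of `D` is near a point at which the boundary distances of `D` and `D \ P` are
comparable: points too close to a puncture are moved to a sphere around it. -/
theorem exists_near [Nontrivial E] (hP : IsSparseIn P D) (hD : IsProperDomain D) {r : ℝ}
    (hr : 0 < r) (hr6 : r < 1 / 6) {z : E} (hz : z ∈ D) :
    ∃ w ∈ D \ P, (1 - r) * dist z w ≤ 2 * r * bdryDist D z ∧
      r * bdryDist D z ≤ (1 + r) * bdryDist (D \ P) w := by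
  have hd := hD.bdryDist_pos hz
  by_cases h : ∃ x ∈ P, dist z x < r * bdryDist D x
  · obtain ⟨x, hx, hzx⟩ := h
    have hdx := hD.bdryDist_pos (hP.subset hx)
    obtain ⟨e, he⟩ := exists_norm_eq E (show (0 : ℝ) ≤ r * bdryDist D x by positivity)
    have hwx : dist (x + e) x = r * bdryDist D x := by simp [dist_eq_norm, he]
    have hw := hP.mem_diff_and_dist_le hD hx (z := x + e)
      (dist_pos.1 (by rw [hwx]; positivity)) (by rw [hwx]; nlinarith)
    rw [hwx] at hw
    refine ⟨x + e, hw.1, ?_, ?_⟩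
    · have h1 := dist_triangle_right z (x + e) x
      have h2 := bdryDist_le_add_dist D x z
      rw [dist_comm x z] at h2
      nlinarith
    · have h2 := bdryDist_le_add_dist D z x
      nlinarith
  · push Not at h
    have key : r / (1 + r) * bdryDist D z ≤ bdryDist (D \ P) z := by
      refine hP.le_bdryDist_diff hD (mul_le_of_le_one_left hd.le ?_) fun x hx => ?_
      · rw [div_le_one (by linarith)]; linarith
      · have h1 := h x hx
        have h2 := bdryDist_le_add_dist D z x
        rw [div_mul_eq_mul_div, div_le_iff₀ (by linarith)]
        nlinarith
    refine ⟨z, ⟨hz, fun hzP => ?_⟩, ?_, ?_⟩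
    · have := h z hzP
      rw [dist_self] at this
      nlinarith
    · rw [dist_self]; nlinarith
    · rw [div_mul_eq_mul_div, div_le_iff₀ (by linarith)] at key
      linarith

theorem qhDist_le_qhDist_diff (hP : IsSparseIn P D) (hD : IsProperDomain D) (a b : E) :
    qhDist D a b ≤ qhDist (D \ P) a b :=
  qhDist_anti sdiff_subset (fun z _ => hP.bdryDist_diff_le hD z) a b

/-- On the scale of the distance to the boundary of `D`, the quasihyperbolic distance of `D \ P` is
at most logarithmic in the relative distance: either a segment avoids `P` by a definite amount, or
both points lie in a ball that is punctured only at its centre. -/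
theorem qhDist_diff_le_of_dist_le (hE : 2 ≤ Module.rank ℝ E) (hP : IsSparseIn P D)
    (hD : IsProperDomain D) {a b : E} (ha : a ∈ D \ P) (hb : b ∈ D \ P)
    (hab : dist a b ≤ bdryDist D a / 20) :
    qhDist (D \ P) a b ≤ ENNReal.ofReal (18 + Real.log (1 + dist a b /
      min (bdryDist (D \ P) a : ℝ) (bdryDist (D \ P) b))) := by
  have hda := hP.bdryDist_diff_pos hD ha
  have hdb := hP.bdryDist_diff_pos hD hb
  have hDa := hD.bdryDist_pos ha.1
  set m : ℝ := min (bdryDist (D \ P) a : ℝ) (bdryDist (D \ P) b) with hm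
  have hm0 : 0 < m := lt_min hda hdb
  have hlog : 0 ≤ Real.log (1 + dist a b / m) := Real.log_nonneg (by
    have : 0 ≤ dist a b / m := by positivity
    linarith)
  rcases le_or_gt (dist a b) (bdryDist (D \ P) a / 2) with h | h
  · refine (qhDist_le_of_dist_le_half hP.isOpen_diff ha hda h).trans (ENNReal.ofReal_le_ofReal ?_)
    have : dist a b / bdryDist (D \ P) a ≤ 1 / 2 := by
      rw [div_le_div_iff₀ hda (by norm_num)]; linarith
    linarith
  obtain ⟨x, hx, hax⟩ : ∃ x ∈ P, dist a x < 2 * dist a b := by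
    by_contra! hcon
    have := hP.le_bdryDist_diff hD (z := a) (m := 2 * dist a b) (by linarith) hcon
    linarith
  have hax0 : a ≠ x := fun hh => ha.2 (hh ▸ hx)
  have hbx0 : b ≠ x := fun hh => hb.2 (hh ▸ hx)
  have hbx : dist b x < 3 * dist a b := by
    have := dist_triangle_left b x a
    linarith
  have hdx : (bdryDist D a : ℝ) ≤ bdryDist D x + dist a x := bdryDist_le_add_dist D a x
  have har : dist a x < bdryDist D x / 6 := by linarith
  have hbr : dist b x < bdryDist D x / 6 := by linarith
  have hr : ∀ z, z ≠ x → dist z x < bdryDist D x / 6 →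
      z ∈ D \ P ∧ dist z x ≤ bdryDist (D \ P) z := fun z h1 h2 =>
    hP.mem_diff_and_dist_le hD hx h1 h2
  have hma : m ≤ dist a x := (min_le_left ..).trans (hP.bdryDist_diff_le_dist hx a)
  have hmb : m ≤ dist b x := (min_le_right ..).trans (hP.bdryDist_diff_le_dist hx b)
  have key : ∀ s R : ℝ, m ≤ s → s ≤ R → R < 3 * dist a b →
      ENNReal.ofReal (16 + Real.log (R / s)) ≤ ENNReal.ofReal (18 + Real.log (1 + dist a b / m)) := by
    intro s R hs hsR hR
    have hs0 : 0 < s := hm0.trans_le hs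
    have h3 : Real.log 3 ≤ 2 := by
      have := Real.log_le_sub_one_of_pos (show (0 : ℝ) < 3 by norm_num)
      linarith
    have h4 : R / s ≤ 3 * (1 + dist a b / m) := by
      calc R / s ≤ 3 * dist a b / m := by gcongr
        _ ≤ 3 * (1 + dist a b / m) := by rw [mul_div_assoc]; linarith
    have h5 : Real.log (R / s) ≤ Real.log (3 * (1 + dist a b / m)) :=
      Real.log_le_log (div_pos (hs0.trans_le hsR) hs0) h4
    rw [Real.log_mul (by norm_num) (by positivity)] at h5
    exact ENNReal.ofReal_le_ofReal (by linarith)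
  rcases le_total (dist a x) (dist b x) with hle | hle
  · exact (qhDist_puncturedBall_le hE hr hax0 hle hbr).trans (key _ _ hma hle hbx)
  · rw [qhDist_comm]
    exact (qhDist_puncturedBall_le hE hr hbx0 hle har).trans (key _ _ hmb hle (by linarith))

/-- If the quasihyperbolic distance of `p` and `q` in `D` is less than `n / 46`, then nearby points
at which the boundary distances of `D` and `D \ P` are comparable have quasihyperbolic distance at
most `21 * n` in `D \ P`: an arc from `p` to `q` is cut into `n` short pieces. -/
theorem qhDist_diff_le_of_qhDist_lt [Nontrivial E] (hE : 2 ≤ Module.rank ℝ E)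
    (hP : IsSparseIn P D) (hD : IsProperDomain D) {n : ℕ} (hn : 1 ≤ n) :
    ∀ {p q a b : E}, p ∈ D → q ∈ D → a ∈ D \ P → b ∈ D \ P →
      dist p a ≤ bdryDist D p / 80 → (bdryDist D p : ℝ) ≤ 162 * bdryDist (D \ P) a →
      dist q b ≤ bdryDist D q / 80 → (bdryDist D q : ℝ) ≤ 162 * bdryDist (D \ P) b →
      qhDist D p q < ENNReal.ofReal (n * (1 / 46)) →
      qhDist (D \ P) a b ≤ ENNReal.ofReal (n * 21) := by
  have base : ∀ {p q a b : E}, p ∈ D → q ∈ D → a ∈ D \ P → b ∈ D \ P →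
      dist p a ≤ bdryDist D p / 80 → (bdryDist D p : ℝ) ≤ 162 * bdryDist (D \ P) a →
      dist q b ≤ bdryDist D q / 80 → (bdryDist D q : ℝ) ≤ 162 * bdryDist (D \ P) b →
      qhDist D p q < ENNReal.ofReal (1 / 46) →
      qhDist (D \ P) a b ≤ ENNReal.ofReal 21 := by
    intro p q a b hp hq ha hb hpa hpa' hqb hqb' hpq
    have hdp := hD.bdryDist_pos hp
    have hda := hP.bdryDist_diff_pos hD ha
    have hdb := hP.bdryDist_diff_pos hD hb
    -- `log (1 + s) < 1 / 46` and `s / (1 + s) ≤ log (1 + s)` give `s < 1 / 45`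
    have hpq' : dist p q ≤ bdryDist D p / 45 := by
      have h1 := (log_le_qhDist hdp q).trans_lt hpq
      rw [ENNReal.ofReal_lt_ofReal_iff (by norm_num)] at h1
      have h2 : 0 ≤ dist p q / bdryDist D p := by positivity
      have h3 := (Real.one_sub_inv_le_log_of_pos
        (show 0 < 1 + dist p q / bdryDist D p by linarith)).trans_lt h1
      have h4 : (45 / 46 : ℝ) < (1 + dist p q / bdryDist D p)⁻¹ := by linarith
      rw [lt_inv_comm₀ (by norm_num) (by linarith)] at h4
      have h5 : dist p q / bdryDist D p ≤ 1 / 45 := by linarith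
      rw [div_le_iff₀ hdp] at h5
      linarith
    have hq1 := bdryDist_le_add_dist D q p
    have hq2 := bdryDist_le_add_dist D p q
    have hp1 := bdryDist_le_add_dist D p a
    rw [dist_comm q p] at hq1
    have htri : dist a b ≤ dist p a + dist p q + dist q b := by
      have h1 := dist_triangle4 a p q b
      rw [dist_comm a p] at h1
      exact h1
    refine (hP.qhDist_diff_le_of_dist_le hE hD ha hb (by linarith)).trans
      (ENNReal.ofReal_le_ofReal ?_)
    have h1 : dist a b / min (bdryDist (D \ P) a : ℝ) (bdryDist (D \ P) b) ≤ 8 := by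
      rw [div_le_iff₀ (lt_min hda hdb)]
      rcases min_choice (bdryDist (D \ P) a : ℝ) (bdryDist (D \ P) b) with h | h <;> rw [h] <;>
        linarith
    have h2 : Real.log (1 + dist a b / min (bdryDist (D \ P) a : ℝ) (bdryDist (D \ P) b)) ≤ 3 := by
      have h0 : 0 ≤ dist a b / min (bdryDist (D \ P) a : ℝ) (bdryDist (D \ P) b) := by positivity
      rw [Real.log_le_iff_le_exp (by linarith)]
      have h3 : Real.exp 3 = Real.exp 1 ^ 3 := by rw [← Real.exp_nat_mul]; norm_num
      have h4 : (2.7 : ℝ) ^ 3 ≤ Real.exp 1 ^ 3 := by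
        gcongr; linarith [Real.exp_one_gt_d9]
      rw [h3]
      norm_num at h4
      linarith
    linarith
  induction n, hn using Nat.le_induction with
  | base =>
    intro p q a b hp hq ha hb hpa hpa' hqb hqb' hpq
    simpa using base hp hq ha hb hpa hpa' hqb hqb' (by simpa using hpq)
  | succ n hn ih =>
    intro p q a b hp hq ha hb hpa hpa' hqb hqb' hpq
    rw [Nat.cast_succ] at hpq
    obtain ⟨w, hw, hpw, hwq⟩ := exists_qhDist_lt_qhDist_lt hD hn (by norm_num) hpq
    -- for `r = 1 / 161`: `2 * r / (1 - r) = 1 / 80` and `(1 + r) / r = 162`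
    obtain ⟨c, hc, hwc, hwc'⟩ := hP.exists_near hD (r := 1 / 161) (by norm_num) (by norm_num) hw
    have hdw := hD.bdryDist_pos hw
    have h1 : dist w c ≤ bdryDist D w / 80 := by linarith
    have h2 : (bdryDist D w : ℝ) ≤ 162 * bdryDist (D \ P) c := by linarith
    calc _ ≤ qhDist (D \ P) a c + qhDist (D \ P) c b := qhDist_triangle ..
      _ ≤ ENNReal.ofReal (n * 21) + ENNReal.ofReal 21 := add_le_add
          (ih hp hw ha hc hpa hpa' h1 h2 hpw) (base hw hq hc hb h1 h2 hqb hqb' hwq)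
      _ = ENNReal.ofReal ((n + 1 : ℕ) * 21) := by
          rw [← ENNReal.ofReal_add (by positivity) (by norm_num)]
          push_cast
          congr 1
          ring

end IsSparseIn

theorem isSparseIn_of_qhDist [NormedSpace ℝ E] [Nontrivial E] (hD : IsProperDomain D)
    (hPD : P ⊆ D) (hPc : P.Countable) (hPclosed : IsClosed ((Subtype.val : D → E) ⁻¹' P))
    (hPsep : ∀ x ∈ P, ∀ y ∈ P, x ≠ y → (1 / 2 : ℝ≥0∞) ≤ qhDist D x y) : IsSparseIn P D := by
  have hopen : IsOpen (D \ P) := by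
    have h1 := hD.isOpen.isOpenMap_subtype_val _ hPclosed.isOpen_compl
    rwa [← preimage_compl, Subtype.image_preimage_coe] at h1
  refine ⟨hPD, hopen, ?_, fun x hx y hy hxy => ?_⟩
  · have hcl : closure (D \ P) = closure D :=
      (closure_mono sdiff_subset).antisymm (closure_minimal
        ((hPc.dense_compl ℝ).open_subset_closure_inter hD.isOpen) isClosed_closure)
    rw [hopen.frontier_eq, hcl, hD.isOpen.frontier_eq]
    ext z
    have h1 : z ∈ P → z ∈ D := fun h => hPD h
    have h2 : z ∈ D → z ∈ closure D := fun h => subset_closure h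
    simp only [mem_sdiff, mem_union]
    tauto
  · by_contra! hlt
    have h0 := dist_nonneg (x := x) (y := y)
    have h1 := (hPsep x hx y hy hxy).trans (qhDist_le_of_dist_lt hD.isOpen (hPD hx)
      (by linarith))
    have h2 : (1 / 2 : ℝ≥0∞) = ENNReal.ofReal (1 / 2) := by
      rw [ENNReal.ofReal_div_of_pos (by norm_num)]; simp
    rw [h2, ENNReal.ofReal_le_ofReal_iff (div_nonneg h0 (by linarith)),
      div_le_div_iff₀ (by norm_num) (by linarith)] at h1
    linarith

end Sparse

/-! ### Comparison of the quasihyperbolic distances of `D` and `D \ P` -/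

section Comparison

variable {E : Type*} [NormedAddCommGroup E] [NormedSpace ℝ E] {D P : Set E}

theorem div_one_add_le_log {t : ℝ} (ht : 0 ≤ t) : t / (1 + t) ≤ Real.log (1 + t) := by
  have h := Real.one_sub_inv_le_log_of_pos (show 0 < 1 + t by linarith)
  have h2 : t / (1 + t) = 1 - (1 + t)⁻¹ := by field_simp; ring
  linarith

namespace IsSparseIn

/-- An endpoint of an arc is replaced by a nearby point at which the boundary distances of `D` and
`D \ P` are comparable. -/
theorem exists_near_qhDist_le [Nontrivial E] (hE : 2 ≤ Module.rank ℝ E) (hP : IsSparseIn P D)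
    (hD : IsProperDomain D) {z : E} (hz : z ∈ D \ P) {τ : ℝ}
    (hτ : bdryDist D z / 80 ≤ τ * bdryDist (D \ P) z) :
    ∃ a ∈ D \ P, dist z a ≤ bdryDist D z / 80 ∧
      (bdryDist D z : ℝ) ≤ 162 * bdryDist (D \ P) a ∧
      qhDist (D \ P) z a ≤ ENNReal.ofReal (21 + Real.log (1 + τ)) := by
  obtain ⟨a, ha, hza, hza'⟩ := hP.exists_near hD (r := 1 / 161) (by norm_num) (by norm_num) hz.1
  have hd := hD.bdryDist_pos hz.1
  have hdz := hP.bdryDist_diff_pos hD hz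
  have hda := hP.bdryDist_diff_pos hD ha
  have hτ0 : 0 < τ := pos_of_mul_pos_left ((by positivity : (0 : ℝ) < _).trans_le hτ) hdz.le
  have h1 : dist z a ≤ bdryDist D z / 80 := by linarith
  have h2 : (bdryDist D z : ℝ) ≤ 162 * bdryDist (D \ P) a := by linarith
  refine ⟨a, ha, h1, h2, (hP.qhDist_diff_le_of_dist_le hE hD hz ha (by linarith)).trans
    (ENNReal.ofReal_le_ofReal ?_)⟩
  have h3 : dist z a / min (bdryDist (D \ P) z : ℝ) (bdryDist (D \ P) a) ≤ 3 + τ := by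
    rw [div_le_iff₀ (lt_min hdz hda)]
    rcases min_choice (bdryDist (D \ P) z : ℝ) (bdryDist (D \ P) a) with h | h <;> rw [h] <;>
      nlinarith
  have h4 : 0 ≤ dist z a / min (bdryDist (D \ P) z : ℝ) (bdryDist (D \ P) a) := by positivity
  have h5 : Real.log (1 + dist z a / min (bdryDist (D \ P) z : ℝ) (bdryDist (D \ P) a)) ≤
      Real.log (4 * (1 + τ)) := Real.log_le_log (by linarith) (by linarith)
  have h6 := Real.log_le_sub_one_of_pos (show (0 : ℝ) < 4 by norm_num)
  rw [Real.log_mul (by norm_num) (by linarith)] at h5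
  linarith

/-- The transfer of an upper bound from `D` to `D \ P`. For distant points, the additive constants
coming from the endpoints and from rounding the number of pieces of an arc are absorbed, as `Q` is
then bounded below. -/
theorem qhDist_diff_le [Nontrivial E] (hE : 2 ≤ Module.rank ℝ E) (hP : IsSparseIn P D)
    (hD : IsProperDomain D) {z₁ z₂ : E} (h₁ : z₁ ∈ D \ P) (h₂ : z₂ ∈ D \ P) {Q : ℝ}
    (hk : qhDist D z₁ z₂ ≤ ENNReal.ofReal Q)
    (hlog : Real.log (1 + dist z₁ z₂ /
      min (bdryDist (D \ P) z₁ : ℝ) (bdryDist (D \ P) z₂)) ≤ Q) :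
    qhDist (D \ P) z₁ z₂ ≤ ENNReal.ofReal (2 ^ 12 * Q) := by
  have hd₁ := hP.bdryDist_diff_pos hD h₁
  have hd₂ := hP.bdryDist_diff_pos hD h₂
  have hD₁ := hD.bdryDist_pos h₁.1
  have hD₂ := hD.bdryDist_pos h₂.1
  have hGD₁ := hP.bdryDist_diff_le hD z₁
  set m : ℝ := min (bdryDist (D \ P) z₁ : ℝ) (bdryDist (D \ P) z₂) with hm
  have hm0 : 0 < m := lt_min hd₁ hd₂
  have hm₁ : m ≤ bdryDist (D \ P) z₁ := min_le_left ..
  have hm₂ : m ≤ bdryDist (D \ P) z₂ := min_le_right ..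
  set τ : ℝ := dist z₁ z₂ / m with hτ
  have hτm : τ * m = dist z₁ z₂ := div_mul_cancel₀ _ hm0.ne'
  have hτ0 : 0 ≤ τ := by positivity
  have hτQ : ∀ s, 0 ≤ s → s ≤ τ → s / (1 + s) ≤ Q := fun s hs hsτ =>
    (div_one_add_le_log hs).trans ((Real.log_le_log (by linarith) (by linarith)).trans hlog)
  rcases le_or_gt (dist z₁ z₂) (bdryDist (D \ P) z₁ / 2) with hs | hs
  -- two points close together compared with the distance to the boundary of `D \ P`
  · refine (qhDist_le_of_dist_le_half hP.isOpen_diff h₁ hd₁ hs).trans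
      (ENNReal.ofReal_le_ofReal ?_)
    set s : ℝ := dist z₁ z₂ / bdryDist (D \ P) z₁ with hs_def
    have hs0 : 0 ≤ s := by positivity
    have hs1 : s ≤ 1 / 2 := by rw [hs_def, div_le_iff₀ hd₁]; linarith
    have hsτ : s ≤ τ := by rw [hs_def, hτ]; gcongr
    have := hτQ s hs0 hsτ
    rw [div_le_iff₀ (by linarith)] at this
    nlinarith
  rcases le_or_gt (dist z₁ z₂) (bdryDist D z₁ / 20) with hl | hl
  -- two points close together compared with the distance to the boundary of `D` only
  · refine (hP.qhDist_diff_le_of_dist_le hE hD h₁ h₂ hl).trans (ENNReal.ofReal_le_ofReal ?_)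
    have h1 : 1 / 2 ≤ τ := by rw [hτ, le_div_iff₀ hm0]; linarith
    have := hτQ (1 / 2) (by norm_num) h1
    norm_num at this
    linarith
  -- two distant points
  · have h1 : 1 / 20 ≤ τ := by rw [hτ, le_div_iff₀ hm0]; linarith
    have hQ := hτQ (1 / 20) (by norm_num) h1
    norm_num at hQ
    have hD21 := bdryDist_le_add_dist D z₂ z₁
    rw [dist_comm z₂ z₁] at hD21
    have e₁ : (bdryDist D z₁ : ℝ) / 80 ≤ τ * bdryDist (D \ P) z₁ := by nlinarith
    have e₂ : (bdryDist D z₂ : ℝ) / 80 ≤ τ * bdryDist (D \ P) z₂ := by nlinarith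
    obtain ⟨a, ha, hza, hza', hka⟩ := hP.exists_near_qhDist_le hE hD h₁ e₁
    obtain ⟨b, hb, hzb, hzb', hkb⟩ := hP.exists_near_qhDist_le hE hD h₂ e₂
    set n : ℕ := ⌊46 * Q⌋₊ + 1 with hn
    have hn1 : 46 * Q < n := by rw [hn]; push_cast; exact Nat.lt_floor_add_one _
    have hn2 : (n : ℝ) ≤ 46 * Q + 1 := by
      rw [hn]; push_cast
      have := Nat.floor_le (show 0 ≤ 46 * Q by linarith)
      linarith
    have hkn : qhDist D z₁ z₂ < ENNReal.ofReal (n * (1 / 46)) := by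
      refine hk.trans_lt ((ENNReal.ofReal_lt_ofReal_iff (by linarith)).2 (by linarith))
    have hab := hP.qhDist_diff_le_of_qhDist_lt hE hD (by omega : 1 ≤ n) h₁.1 h₂.1 ha hb hza hza'
      hzb hzb' hkn
    rw [qhDist_comm] at hkb
    have hlog0 : 0 ≤ Real.log (1 + τ) := Real.log_nonneg (by linarith)
    calc _ ≤ qhDist (D \ P) z₁ a + (qhDist (D \ P) a b + qhDist (D \ P) b z₂) :=
          (qhDist_triangle _ _ a _).trans (add_le_add le_rfl (qhDist_triangle _ _ b _))
      _ ≤ ENNReal.ofReal (21 + Real.log (1 + τ)) + (ENNReal.ofReal (n * 21) +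
            ENNReal.ofReal (21 + Real.log (1 + τ))) :=
          add_le_add hka (add_le_add hab hkb)
      _ = ENNReal.ofReal (21 + Real.log (1 + τ) + (n * 21 + (21 + Real.log (1 + τ)))) := by
          rw [← ENNReal.ofReal_add (by positivity) (by positivity),
            ← ENNReal.ofReal_add (by positivity) (by positivity)]
      _ ≤ _ := ENNReal.ofReal_le_ofReal (by linarith)

/-- Every point of `D` is close to a point of `D \ P` at which the boundary distances of `D` and
`D \ P` are comparable; this passes uniformity from `D \ P` to `D`. -/
theorem isPsiUniform_of_diff [Nontrivial E] (hP : IsSparseIn P D) (hD : IsProperDomain D)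
    {ψ₁ ψ : ℝ≥0 ≃ₜ ℝ≥0} (hψ₁ : IsPsiUniform ψ₁ (D \ P))
    (hψ : ∀ t, ψ t = 3 * ψ₁ (2 ^ 7 * t)) : IsPsiUniform ψ D := by
  refine ⟨hD, fun z₁ h₁ z₂ h₂ => ?_⟩
  have hD₁ := hD.bdryDist_pos h₁
  have hD₂ := hD.bdryDist_pos h₂
  set t : ℝ≥0 := nndist z₁ z₂ / min (bdryDist D z₁) (bdryDist D z₂) with ht
  have ht' : (t : ℝ) = dist z₁ z₂ / min (bdryDist D z₁ : ℝ) (bdryDist D z₂) := by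
    rw [ht]; push_cast; rfl
  set T : ℝ := (ψ₁ (2 ^ 7 * t) : ℝ) with hT
  have hlogT : Real.log (1 + 2 ^ 7 * t) ≤ T := by
    have := hψ₁.log_le (2 ^ 7 * t)
    rwa [NNReal.coe_mul, NNReal.coe_pow, NNReal.coe_ofNat] at this
  have hgoal : ((ψ t : ℝ≥0) : ℝ≥0∞) = ENNReal.ofReal (3 * T) := by
    rw [hψ, ← ENNReal.ofReal_coe_nnreal, NNReal.coe_mul, NNReal.coe_ofNat]
  rw [hgoal]
  have hmin : 0 < min (bdryDist D z₁ : ℝ) (bdryDist D z₂) := lt_min hD₁ hD₂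
  have htT : ∀ s, 0 ≤ s → s ≤ 2 ^ 7 * (t : ℝ) → s / (1 + s) ≤ T := fun s hs hst =>
    (div_one_add_le_log hs).trans ((Real.log_le_log (by linarith) (by linarith)).trans hlogT)
  rcases le_or_gt (dist z₁ z₂) (bdryDist D z₁ / 2) with hs | hs
  · refine (qhDist_le_of_dist_le_half hD.isOpen h₁ hD₁ hs).trans (ENNReal.ofReal_le_ofReal ?_)
    set s : ℝ := dist z₁ z₂ / bdryDist D z₁ with hs_def
    have hs0 : 0 ≤ s := by positivity
    have hs1 : s ≤ 1 / 2 := by rw [hs_def, div_le_iff₀ hD₁]; linarith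
    have hst : s ≤ t := by rw [hs_def, ht']; gcongr; exact min_le_left ..
    have := htT s hs0 (by linarith)
    rw [div_le_iff₀ (by linarith)] at this
    nlinarith
  · have ht2 : 1 / 2 ≤ (t : ℝ) := by
      rw [ht', le_div_iff₀ hmin]
      have := min_le_left (bdryDist D z₁ : ℝ) (bdryDist D z₂)
      linarith
    have hT9 := htT 64 (by norm_num) (by linarith)
    norm_num at hT9
    have hD21 := bdryDist_le_add_dist D z₂ z₁
    rw [dist_comm z₂ z₁] at hD21
    obtain ⟨w₁, hw₁, hzw₁, hzw₁'⟩ :=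
      hP.exists_near hD (r := 1 / 16) (by norm_num) (by norm_num) h₁
    obtain ⟨w₂, hw₂, hzw₂, hzw₂'⟩ :=
      hP.exists_near hD (r := 1 / 16) (by norm_num) (by norm_num) h₂
    have near : ∀ {z w : E}, z ∈ D → (1 - 1 / 16 : ℝ) * dist z w ≤ 2 * (1 / 16) * bdryDist D z →
        qhDist D z w ≤ ENNReal.ofReal (4 / 15) := fun {z w} hz hzw => by
      have hdz := hD.bdryDist_pos hz
      refine (qhDist_le_of_dist_le_half hD.isOpen hz hdz (by linarith)).trans
        (ENNReal.ofReal_le_ofReal ?_)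
      rw [← mul_div_assoc, div_le_iff₀ hdz]
      linarith
    have hk₁ := near h₁ hzw₁
    have hk₂ := near h₂ hzw₂
    rw [qhDist_comm] at hk₂
    have hdw₁ := hP.bdryDist_diff_pos hD hw₁
    have hdw₂ := hP.bdryDist_diff_pos hD hw₂
    have hww : dist w₁ w₂ ≤ dist z₁ w₁ + dist z₁ z₂ + dist z₂ w₂ := by
      have := dist_triangle4 w₁ z₁ z₂ w₂
      rwa [dist_comm w₁ z₁] at this
    have hratio : nndist w₁ w₂ / min (bdryDist (D \ P) w₁) (bdryDist (D \ P) w₂) ≤ 2 ^ 7 * t := by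
      rw [← NNReal.coe_le_coe]
      push_cast
      rw [ht', div_le_iff₀ (lt_min hdw₁ hdw₂), mul_assoc, div_mul_eq_mul_div, ← mul_div_assoc,
        le_div_iff₀ hmin]
      have h1 : min (bdryDist D z₁ : ℝ) (bdryDist D z₂) ≤
          17 * min (bdryDist (D \ P) w₁ : ℝ) (bdryDist (D \ P) w₂) := by
        rcases min_choice (bdryDist (D \ P) w₁ : ℝ) (bdryDist (D \ P) w₂) with h | h <;> rw [h]
        · exact (min_le_left ..).trans (by linarith)
        · exact (min_le_right ..).trans (by linarith)
      have h2 : dist w₁ w₂ ≤ 2 * dist z₁ z₂ := by linarith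
      calc _ ≤ 2 * dist z₁ z₂ *
            (17 * min (bdryDist (D \ P) w₁ : ℝ) (bdryDist (D \ P) w₂)) := by
            gcongr
        _ ≤ _ := by
          have : 0 ≤ dist z₁ z₂ * min (bdryDist (D \ P) w₁ : ℝ) (bdryDist (D \ P) w₂) := by
            positivity
          linarith
    have hkw : qhDist D w₁ w₂ ≤ ENNReal.ofReal T := by
      refine (hP.qhDist_le_qhDist_diff hD w₁ w₂).trans ((hψ₁.qhDist_le w₁ hw₁ w₂ hw₂).trans ?_)
      rw [hT, ENNReal.ofReal_coe_nnreal]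
      exact_mod_cast (strictMono_nnreal_homeomorph ψ₁).monotone hratio
    calc _ ≤ qhDist D z₁ w₁ + (qhDist D w₁ w₂ + qhDist D w₂ z₂) :=
          (qhDist_triangle _ _ w₁ _).trans (add_le_add le_rfl (qhDist_triangle _ _ w₂ _))
      _ ≤ ENNReal.ofReal (4 / 15) + (ENNReal.ofReal T + ENNReal.ofReal (4 / 15)) :=
          add_le_add hk₁ (add_le_add hkw hk₂)
      _ = ENNReal.ofReal (4 / 15 + (T + 4 / 15)) := by
          rw [← ENNReal.ofReal_add (by linarith) (by norm_num),
            ← ENNReal.ofReal_add (by norm_num) (by linarith)]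
      _ ≤ _ := ENNReal.ofReal_le_ofReal (by linarith)

/-- The connectedness of `D \ P` comes with the bound: finite quasihyperbolic distance means that
there is a connecting arc. -/
theorem isPsiUniform_diff [Nontrivial E] (hE : 2 ≤ Module.rank ℝ E) (hP : IsSparseIn P D)
    {ψ ψ₁ : ℝ≥0 ≃ₜ ℝ≥0} (hψ : IsPsiUniform ψ D) (hψ₁ : ∀ t, ψ₁ t = 2 ^ 12 * ψ t) :
    IsPsiUniform ψ₁ (D \ P) := by
  have hD := hψ.domain
  have bound : ∀ z₁ ∈ D \ P, ∀ z₂ ∈ D \ P, qhDist (D \ P) z₁ z₂ ≤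
      (ψ₁ (nndist z₁ z₂ / min (bdryDist (D \ P) z₁) (bdryDist (D \ P) z₂)) : ℝ≥0∞) := by
    intro z₁ h₁ z₂ h₂
    set t : ℝ≥0 := nndist z₁ z₂ / min (bdryDist (D \ P) z₁) (bdryDist (D \ P) z₂) with ht
    have ht' : (t : ℝ) =
        dist z₁ z₂ / min (bdryDist (D \ P) z₁ : ℝ) (bdryDist (D \ P) z₂) := by
      rw [ht]; push_cast; rfl
    have hmin : 0 < min (bdryDist (D \ P) z₁) (bdryDist (D \ P) z₂) :=
      lt_min (hP.bdryDist_diff_pos hD h₁) (hP.bdryDist_diff_pos hD h₂)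
    have hle : nndist z₁ z₂ / min (bdryDist D z₁) (bdryDist D z₂) ≤ t := by
      rw [ht]
      gcongr
      · exact hP.bdryDist_diff_le hD z₁
      · exact hP.bdryDist_diff_le hD z₂
    have hk : qhDist D z₁ z₂ ≤ ENNReal.ofReal (ψ t) := by
      rw [ENNReal.ofReal_coe_nnreal]
      refine (hψ.qhDist_le z₁ h₁.1 z₂ h₂.1).trans ?_
      exact_mod_cast (strictMono_nnreal_homeomorph ψ).monotone hle
    have := hP.qhDist_diff_le hE hD h₁ h₂ hk (ht' ▸ hψ.log_le t)
    refine this.trans_eq ?_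
    rw [hψ₁, ← ENNReal.ofReal_coe_nnreal]
    push_cast
    rfl
  refine ⟨⟨hP.isOpen_diff, ⟨?_, ?_⟩, ?_⟩, bound⟩
  · obtain ⟨z, hz⟩ := hD.isConnected.nonempty
    obtain ⟨w, hw, -⟩ := hP.exists_near hD (r := 1 / 16) (by norm_num) (by norm_num) hz
    exact ⟨w, hw⟩
  · refine isPreconnected_of_forall_pair fun z₁ h₁ z₂ h₂ => ?_
    exact exists_isPreconnected_of_qhDist_ne_top (ne_top_of_le_ne_top ENNReal.coe_ne_top (bound z₁ h₁ z₂ h₂))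
  · intro h
    exact hD.ne_univ (univ_subset_iff.1 (h ▸ sdiff_subset))

end IsSparseIn

end Comparison

end

theorem theorem1p1 {E : Type*} [NormedAddCommGroup E] [NormedSpace ℝ E] [CompleteSpace E]
    (hE : 2 ≤ Module.rank ℝ E)
    (D : Set E) (hD : IsProperDomain D)
    (P : Set E) (hPD : P ⊆ D) (hPc : P.Countable)
    (hPclosed : IsClosed ((Subtype.val : D → E) ⁻¹' P))
    (hPsep : ∀ x ∈ P, ∀ y ∈ P, x ≠ y → (1 / 2 : ℝ≥0∞) ≤ qhDist D x y) :
    (∀ ψ : ℝ≥0 ≃ₜ ℝ≥0, IsPsiUniform ψ D →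
      ∃ ψ₁ : ℝ≥0 ≃ₜ ℝ≥0, (∀ t, ψ₁ t = 2 ^ 12 * ψ t) ∧ IsPsiUniform ψ₁ (D \ P)) ∧
    (∀ ψ₁ : ℝ≥0 ≃ₜ ℝ≥0, IsPsiUniform ψ₁ (D \ P) →
      ∃ ψ : ℝ≥0 ≃ₜ ℝ≥0, (∀ t, ψ t = 3 * ψ₁ (2 ^ 7 * t)) ∧ IsPsiUniform ψ D) := by
  have hnt : Nontrivial E := rank_pos_iff_nontrivial.1 (lt_of_lt_of_le (by norm_num) hE)
  have hP : IsSparseIn P D := isSparseIn_of_qhDist hD hPD hPc hPclosed hPsep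
  refine ⟨fun ψ hψ => ?_, fun ψ₁ hψ₁ => ?_⟩
  · exact ⟨ψ.trans (Homeomorph.mulLeft₀ (2 ^ 12) (by norm_num)), fun t => rfl,
      hP.isPsiUniform_diff hE hψ fun t => rfl⟩
  · exact ⟨((Homeomorph.mulLeft₀ (2 ^ 7) (by norm_num)).trans ψ₁).trans
      (Homeomorph.mulLeft₀ 3 (by norm_num)), fun t => rfl,
      hP.isPsiUniform_of_diff hD hψ₁ fun t => rfl⟩
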